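/- Let $a>0$, let $H_a(x)=\dfrac{1}{e^{ax}+e^{-ax}}$ for $x\in\mathbb R$, and let $\Gamma\subset\mathbb R$ be a separated set, i.e. there is $\delta>0$ with $|\gamma-\gamma'|\ge\delta$ for all distinct $\gamma,\gamma'\in\Gamma$. Let $V^1_\Gamma(H_a)$ be the space of functions $f:\mathbb R\to\mathbb C$ of the form $$f(x)=\sum_{\gamma\in\Gamma}c_\gamma H_a(x-\gamma)\quad(x\in\mathbb R),\qquad (c_\gamma)_{\gamma\in\Gamma}\in\ell^1(\Gamma),\ c_\gamma\in\mathbb C.$$ Let $f\in V^1_\Gamma(H_a)$, and let $(c_\gamma(f))_{\gamma\in\Gamma}\in\ell^1(\Gamma)$ be the coefficients in such a representation of $f$. Then: (i) $e^{2ax}f(x)\in L^1(\mathbb R)$ if and only if $$\sum_{\gamma\in\Gamma}e^{2a\gamma}|c_\gamma(f)|<\infty\quad\text{and}\quad\sum_{\gamma\in\Gamma}e^{a\gamma}c_\gamma(f)=0,$$ and in this case the function $x\mapsto e^{2ax}f(x)$ belongs to $V^1_\Gamma(H_a)$. (ii) $e^{-2ax}f(x)\in L^1(\mathbb R)$ if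 and only if $$\sum_{\gamma\in\Gamma}e^{-2a\gamma}|c_\gamma(f)|<\infty\quad\text{and}\quad\sum_{\gamma\in\Gamma}e^{-a\gamma}c_\gamma(f)=0,$$ and in this case the function $x\mapsto e^{-2ax}f(x)$ belongs to $V^1_\Gamma(H_a)$. -/

import Mathlib

open scoped ENNReal

/-- A set `Γ ⊆ ℝ` is separated: the distances between distinct points of `Γ` are bounded away
from zero. -/
def IsSeparatedSet (Γ : Set ℝ) : Prop :=
  ∃ δ : ℝ, 0 < δ ∧ ∀ γ ∈ Γ, ∀ γ' ∈ Γ, γ ≠ γ' → δ ≤ |γ - γ'|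

/-- `c` is a family of coefficients of `f` with respect to the translates of `g` along `Γ`:
`c ∈ ℓᵖ(Γ)` and `f x = ∑_{γ ∈ Γ} c γ * g (x - γ)` (unconditionally convergent) for every `x`. -/
def IsCoeffs (p : ℝ≥0∞) (Γ : Set ℝ) (g : ℝ → ℂ) (f : ℝ → ℂ) (c : Γ → ℂ) : Prop :=
  Memℓp c p ∧ ∀ x : ℝ, HasSum (fun γ : Γ => c γ * g (x - (γ : ℝ))) (f x)

/-- The quasi shift-invariant space `V^p_Γ(g)`. -/
def quasiShiftInvariantSpace (p : ℝ≥0∞) (Γ : Set ℝ) (g : ℝ → ℂ) : Set (ℝ → ℂ) :=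
  {f | ∃ c : Γ → ℂ, IsCoeffs p Γ g f c}

/-- The hyperbolic secant generator `H_a(x) = 1 / (e^{ax} + e^{-ax})`. -/
noncomputable def hypSecant (a : ℝ) (x : ℝ) : ℂ :=
  ((1 / (Real.exp (a * x) + Real.exp (-(a * x))) : ℝ) : ℂ)

section

open Filter Topology

/-! For `b = ±a`, `e^{2bx} H_a(x-γ) = e^{bx} e^{bγ} - e^{2bγ} H_a(x-γ)` (`exp_mul_hypSecant_sub`).
Hence, once the weighted coefficients `e^{2bγ} c_γ` are summable, `e^{2bx} f` is `e^{bx} S` minus an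
integrable element of `V^1_Γ(H_a)`, with `S = ∑ e^{bγ} c_γ`. Since `e^{bx}` is not integrable,
integrability of `e^{2bx} f` amounts to `S = 0`, and membership in the space follows.

The substantial point is that integrability forces weighted summability
(`IsCoeffs.summable_of_integrable`). Pairing `H_a(· - y)` with the sum of the two imaginary shifts
by `±π/(2a)` of a Gaussian centred at `z` gives a constant times `e^{-N(y-z)²}`, by a contour
integral. Testing `f` at the points of `Γ` therefore yields a Gaussian matrix applied to `c`. For
large `N` separation makes this matrix a small perturbation of a multiple of the identity, even with
exponential weights, and a Schur test recovers the weighted `ℓ¹` bound. -/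

/-! ### Size and integral of the hyperbolic secant -/

theorem hypSecant_eq_cosh (a x : ℝ) :
    hypSecant a x = ((2 * Real.cosh (a * x))⁻¹ : ℝ) := by
  rw [hypSecant, Real.cosh_eq]
  congr 1
  field_simp

theorem continuous_hypSecant (a : ℝ) : Continuous (hypSecant a) := by
  have h : hypSecant a = fun x => (((2 * Real.cosh (a * x))⁻¹ : ℝ) : ℂ) :=
    funext (hypSecant_eq_cosh a)
  rw [h]
  refine Complex.continuous_ofReal.comp (Continuous.inv₀ (by fun_prop) fun x => ?_)
  have := Real.cosh_pos (a * x)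
  positivity

theorem norm_hypSecant (a x : ℝ) : ‖hypSecant a x‖ = (2 * Real.cosh (a * x))⁻¹ := by
  rw [hypSecant_eq_cosh, Complex.norm_real, Real.norm_of_nonneg]
  have := Real.cosh_pos (a * x)
  positivity

theorem norm_hypSecant_le_one (a x : ℝ) : ‖hypSecant a x‖ ≤ 1 := by
  rw [norm_hypSecant]
  exact inv_le_one_of_one_le₀ (by linarith [Real.one_le_cosh (a * x)])

theorem norm_hypSecant_le (a x : ℝ) : ‖hypSecant a x‖ ≤ 2 * (1 + (a * x) ^ 2)⁻¹ := by
  rw [norm_hypSecant, ← inv_inv (2 : ℝ), ← mul_inv, inv_inv]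
  have h1 := Real.quadratic_le_exp_of_nonneg (abs_nonneg (a * x))
  have h2 := Real.exp_pos (-|a * x|)
  have h3 := abs_nonneg (a * x)
  have h4 : |a * x| ^ 2 = (a * x) ^ 2 := sq_abs _
  have h5 := Real.cosh_eq |a * x|
  rw [Real.cosh_abs] at h5
  refine inv_anti₀ (by positivity) ?_
  linarith

theorem integrable_hypSecant {a : ℝ} (ha : a ≠ 0) :
    MeasureTheory.Integrable (hypSecant a) := by
  refine MeasureTheory.Integrable.mono'
    ((integrable_inv_one_add_sq.comp_mul_left' ha).const_mul 2)
    (continuous_hypSecant a).aestronglyMeasurable (.of_forall fun x => norm_hypSecant_le a x)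

theorem integral_norm_hypSecant_pos {a : ℝ} (ha : a ≠ 0) : 0 < ∫ x, ‖hypSecant a x‖ := by
  refine MeasureTheory.integral_pos_of_integrable_nonneg_nonzero (x := 0)
    (continuous_hypSecant a).norm (integrable_hypSecant ha).norm (fun x => norm_nonneg _) ?_
  simp [norm_hypSecant]

theorem integral_hypSecant (a : ℝ) :
    ∫ x, hypSecant a x = ((∫ x, ‖hypSecant a x‖ : ℝ) : ℂ) := by
  rw [← integral_complex_ofReal]
  congr 1 with x
  rw [norm_hypSecant, hypSecant_eq_cosh]

/-! ### A contour integral in the strip `|Im w| ≤ π/(2a)` -/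

theorem Complex.normSq_sinh (z : ℂ) :
    Complex.normSq (Complex.sinh z) = Real.sinh z.re ^ 2 + Real.sin z.im ^ 2 := by
  have h : Complex.sinh z =
      ((Real.sinh z.re * Real.cos z.im : ℝ) : ℂ) + (Real.cosh z.re * Real.sin z.im : ℝ) * I := by
    conv_lhs => rw [← Complex.re_add_im z, Complex.sinh_add, Complex.sinh_mul_I, Complex.cosh_mul_I]
    push_cast
    ring
  rw [h, Complex.normSq_add_mul_I]
  have h1 := Real.cosh_sq z.re
  have h2 := Real.sin_sq_add_cos_sq z.im
  rw [mul_pow, mul_pow, h1]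
  linear_combination (Real.sinh z.re ^ 2) * h2

theorem Complex.abs_sinh_re_le_norm_sinh (z : ℂ) : |Real.sinh z.re| ≤ ‖Complex.sinh z‖ := by
  refine abs_le_of_sq_le_sq' ?_ (norm_nonneg _) |> abs_le.mpr
  rw [← Complex.normSq_eq_norm_sq, Complex.normSq_sinh]
  linarith [sq_nonneg (Real.sin z.im)]

theorem Complex.sinh_ne_zero_of_abs_im_lt_pi {z : ℂ} (hz : z ≠ 0) (him : |z.im| < Real.pi) :
    Complex.sinh z ≠ 0 := by
  intro h
  have h1 := Complex.normSq_sinh z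
  rw [h, map_zero] at h1
  have h2 : Real.sinh z.re = 0 := by
    nlinarith [sq_nonneg (Real.sin z.im), sq_nonneg (Real.sinh z.re)]
  have h3 : Real.sin z.im = 0 := by
    nlinarith [sq_nonneg (Real.sin z.im), sq_nonneg (Real.sinh z.re)]
  rw [Real.sinh_eq_zero] at h2
  rw [abs_lt] at him
  rw [Real.sin_eq_zero_iff_of_lt_of_lt him.1 him.2] at h3
  exact hz (Complex.ext h2 h3)

/-- The quotient `(g w - g 0) / sinh (a w)` with its removable singularity at `0` filled in. -/
noncomputable def sinhQuotient (a : ℝ) (g : ℂ → ℂ) (w : ℂ) : ℂ :=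
  dslope g 0 w / dslope (fun w => Complex.sinh (a * w)) 0 w

theorem sinhQuotient_of_ne (a : ℝ) (g : ℂ → ℂ) {w : ℂ} (hw : w ≠ 0) :
    sinhQuotient a g w = (g w - g 0) / Complex.sinh (a * w) := by
  rw [sinhQuotient, dslope_of_ne _ hw, dslope_of_ne _ hw, slope_def_field, slope_def_field]
  simp only [sub_zero, mul_zero, Complex.sinh_zero]
  rw [div_div_div_cancel_right₀ hw]

theorem differentiableAt_sinhQuotient {a : ℝ} (ha : 0 < a) {g : ℂ → ℂ} (hg : Differentiable ℂ g)
    {w : ℂ} (hw : |w.im| < Real.pi / a) : DifferentiableAt ℂ (sinhQuotient a g) w := by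
  have key : ∀ h : ℂ → ℂ, Differentiable ℂ h → DifferentiableAt ℂ (dslope h 0) w := fun h hh =>
    ((Complex.differentiableOn_dslope (s := Set.univ) (c := 0) univ_mem).mpr
      hh.differentiableOn).differentiableAt univ_mem
  refine (key g hg).div (key _ (by fun_prop)) ?_
  by_cases h0 : w = 0
  · subst h0
    rw [dslope_same]
    have : HasDerivAt (fun w : ℂ => Complex.sinh (a * w)) (Complex.cosh (a * 0) * (a * 1)) 0 :=
      ((hasDerivAt_id (0 : ℂ)).const_mul (a : ℂ)).csinh
    rw [this.deriv]
    simpa using ha.ne'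
  · rw [dslope_of_ne _ h0, slope_def_field]
    simp only [sub_zero, mul_zero, Complex.sinh_zero]
    refine div_ne_zero (Complex.sinh_ne_zero_of_abs_im_lt_pi ?_ ?_) h0
    · simp [h0, ha.ne']
    · rw [Complex.im_ofReal_mul, abs_mul, abs_of_pos ha]
      rwa [lt_div_iff₀' ha] at hw

/-- When `cos (a s) = 0`, `sinh (a (x + i s))` reduces to `i sin (a s) cosh (a x)`, so the
horizontal sides of the contour carry the kernel `H_a`. -/
theorem sinhQuotient_add_mul_I {a s : ℝ} (h : Real.cos (a * s) = 0) (g : ℂ → ℂ) (x : ℝ) :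
    sinhQuotient a g (x + s * Complex.I) = -(2 * Complex.I * Real.sin (a * s)) *
      (hypSecant a x * (g (x + s * Complex.I) - g 0)) := by
  have hne : (x : ℂ) + s * Complex.I ≠ 0 := by
    intro h0
    have hs : s = 0 := by simpa using congrArg Complex.im h0
    simp [hs] at h
  have h1 : (a : ℂ) * (x + s * Complex.I) = (a * x : ℝ) + (a * s : ℝ) * Complex.I := by
    push_cast
    ring
  have hsin : Real.sin (a * s) ^ 2 = 1 := by
    rw [Real.sin_sq, h]
    ring
  rw [sinhQuotient_of_ne _ _ hne, h1, Complex.sinh_add, Complex.sinh_mul_I, Complex.cosh_mul_I,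
    ← Complex.ofReal_cos, ← Complex.ofReal_sin, h, ← Complex.ofReal_cosh, hypSecant_eq_cosh]
  have hc : (Real.cosh (a * x) : ℂ) ≠ 0 := by exact_mod_cast (Real.cosh_pos _).ne'
  have hsin' : (Real.sin (a * s) : ℂ) ^ 2 = 1 := by exact_mod_cast hsin
  have hsin0 : (Real.sin (a * s) : ℂ) ≠ 0 := by
    intro h0
    simp [h0] at hsin'
  generalize g (x + s * Complex.I) - g 0 = w
  generalize (Real.sin (a * s) : ℂ) = σ at *
  generalize Real.cosh (a * x) = k at *
  have hI := Complex.I_sq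
  push_cast
  rw [mul_zero, zero_add, div_eq_iff (by simp [hc, hsin0])]
  field_simp
  rw [hsin', hI]
  ring

/-- Convolution with `hypSecant a` inverts the sum of the two imaginary shifts by `π / (2a)`. -/
theorem integral_hypSecant_mul_shift_sub {a : ℝ} (ha : 0 < a) {g : ℂ → ℂ}
    (hg : Differentiable ℂ g) {B : ℝ} (hB : ∀ z : ℂ, |z.im| ≤ Real.pi / (2 * a) → ‖g z‖ ≤ B) :
    ∫ x : ℝ, hypSecant a x * (g (x + (Real.pi / (2 * a) : ℝ) * Complex.I) +
      g (x + (-(Real.pi / (2 * a)) : ℝ) * Complex.I) - 2 * g 0) = 0 := by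
  set β : ℝ := Real.pi / (2 * a) with hβ
  have hβ0 : 0 < β := by positivity
  have hβa : β < Real.pi / a := by
    rw [hβ, mul_comm, ← div_div]
    exact half_lt_self (by positivity)
  have haβ : a * β = Real.pi / 2 := by
    rw [hβ]
    field_simp
  have hcos : Real.cos (a * β) = 0 := by rw [haβ, Real.cos_pi_div_two]
  have hsin : Real.sin (a * β) = 1 := by rw [haβ, Real.sin_pi_div_two]
  have hcos' : Real.cos (a * -β) = 0 := by rw [mul_neg, Real.cos_neg, hcos]
  have hsin' : Real.sin (a * -β) = -1 := by rw [mul_neg, Real.sin_neg, hsin]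
  have hgc : Continuous g := hg.continuous
  have hint : ∀ s : ℝ, |s| ≤ β →
      MeasureTheory.Integrable fun x : ℝ => hypSecant a x * (g (x + s * Complex.I) - g 0) := by
    intro s hs
    refine (integrable_hypSecant ha.ne').mul_bdd (c := B + B)
      (by fun_prop) (.of_forall fun x => ?_)
    refine (norm_sub_le _ _).trans (add_le_add (hB _ ?_) (hB _ ?_))
    · simpa using hs
    · simpa using hβ0.le
  have hβs : |β| ≤ β := (abs_of_pos hβ0).le
  have hβs' : |-β| ≤ β := by rw [abs_neg]; exact hβs
  have hI1 := (hint β hβs).const_mul (-(2 * Complex.I))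
  have hI2 := (hint (-β) hβs').const_mul (2 * Complex.I)
  -- The vertical sides vanish in the limit: `g` is bounded on the strip and `|sinh (a w)| ≥ |sinh
  -- (a Re w)|`.
  have hV : ∀ T : ℝ, T ≠ 0 → ‖∫ y in (-β)..β, sinhQuotient a g (T + y * Complex.I)‖ ≤
      (2 * B * |2 * β|) * |Real.sinh (a * T)|⁻¹ := by
    intro T hT
    refine (intervalIntegral.norm_integral_le_of_norm_le_const (C := 2 * B * |Real.sinh (a * T)|⁻¹)
      fun y hy => ?_).trans (le_of_eq ?_)
    · rw [Set.uIoc_of_le (by linarith)] at hy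
      have hy' : |y| ≤ β := abs_le.mpr ⟨hy.1.le, hy.2⟩
      have hne : (T : ℂ) + y * Complex.I ≠ 0 := fun h => hT (by simpa using congrArg Complex.re h)
      rw [sinhQuotient_of_ne _ _ hne, norm_div, div_eq_mul_inv]
      have h1 := Complex.abs_sinh_re_le_norm_sinh (a * (T + y * Complex.I))
      simp only [Complex.add_re, Complex.ofReal_re, Complex.mul_re,
        Complex.I_re, Complex.ofReal_im, Complex.I_im, mul_zero, zero_mul, sub_zero, add_zero] at h1
      have h2 : 0 < |Real.sinh (a * T)| := by
        rw [abs_pos, Ne, Real.sinh_eq_zero]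
        exact mul_ne_zero ha.ne' hT
      have h3 : ‖g (T + y * Complex.I) - g 0‖ ≤ 2 * B := by
        rw [two_mul]
        refine (norm_sub_le _ _).trans (add_le_add (hB _ ?_) (hB _ ?_))
        · simpa using hy'
        · simpa using hβ0.le
      have := (norm_nonneg _).trans h3
      gcongr
    · rw [sub_neg_eq_add, ← two_mul]
      ring
  have hsinh : Tendsto (fun T : ℝ => |Real.sinh (a * T)|⁻¹) atTop (𝓝 0) := by
    refine Tendsto.inv_tendsto_atTop (tendsto_abs_atTop_atTop.comp ?_)
    refine tendsto_atTop_mono' atTop ?_ (tendsto_id.const_mul_atTop ha)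
    filter_upwards [eventually_ge_atTop 0] with T hT
    exact Real.self_le_sinh_iff.mpr (by positivity)
  have hV1 : Tendsto (fun T : ℝ => ∫ y in (-β)..β, sinhQuotient a g (T + y * Complex.I))
      atTop (𝓝 0) := by
    refine squeeze_zero_norm' ?_ (mul_zero (2 * B * |2 * β|) ▸ hsinh.const_mul (2 * B * |2 * β|))
    filter_upwards [eventually_gt_atTop 0] with T hT using hV T hT.ne'
  have hV2 : Tendsto (fun T : ℝ => ∫ y in (-β)..β,
      sinhQuotient a g ((-T : ℝ) + y * Complex.I)) atTop (𝓝 0) := by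
    refine squeeze_zero_norm' ?_ (mul_zero (2 * B * |2 * β|) ▸ hsinh.const_mul (2 * B * |2 * β|))
    filter_upwards [eventually_gt_atTop 0] with T hT
    simpa only [mul_neg, Real.sinh_neg, abs_neg] using hV (-T) (by linarith)
  have hH1 := MeasureTheory.intervalIntegral_tendsto_integral hI1
    tendsto_neg_atTop_atBot tendsto_id
  have hH2 := MeasureTheory.intervalIntegral_tendsto_integral hI2
    tendsto_neg_atTop_atBot tendsto_id
  -- Subtracting `g 0` removes the pole at `0`, and `β < π / a` excludes the other zeros of `sinh (a
  -- w)`. The sign change of `sin (a s)` between the two sides cancels their opposite orientation,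
  -- so the shifts add.
  have hrect : ∀ T : ℝ,
      (∫ x in (-T)..T, 2 * Complex.I * (hypSecant a x * (g (x + (-β : ℝ) * Complex.I) - g 0))) -
      (∫ x in (-T)..T, -(2 * Complex.I) * (hypSecant a x * (g (x + β * Complex.I) - g 0))) +
      Complex.I • (∫ y in (-β)..β, sinhQuotient a g (T + y * Complex.I)) -
      Complex.I • (∫ y in (-β)..β, sinhQuotient a g ((-T : ℝ) + y * Complex.I)) = 0 := by
    intro T
    have := Complex.integral_boundary_rect_eq_zero_of_differentiableOn (sinhQuotient a g)
      ⟨-T, -β⟩ ⟨T, β⟩ ?_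
    · simp only [sinhQuotient_add_mul_I hcos, sinhQuotient_add_mul_I hcos', hsin', hsin] at this
      simpa using this
    · intro z hz
      refine (differentiableAt_sinhQuotient ha hg ?_).differentiableWithinAt
      have h2 := hz.2
      simp only [Set.mem_preimage] at h2
      rw [Set.uIcc_of_le (by linarith)] at h2
      exact (abs_le.mpr h2).trans_lt hβa
  have hlim := ((hH2.sub hH1).add (hV1.const_smul Complex.I)).sub (hV2.const_smul Complex.I)
  have h0 := tendsto_nhds_unique (hlim.congr fun T => by simpa using hrect T) tendsto_const_nhds
  rw [smul_zero, add_zero, sub_zero, ← MeasureTheory.integral_sub hI2 hI1] at h0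
  have h1 : ∫ x : ℝ, 2 * Complex.I * (hypSecant a x * (g (x + (β : ℝ) * Complex.I) +
      g (x + (-β : ℝ) * Complex.I) - 2 * g 0)) = 0 := by
    refine Eq.trans ?_ h0
    congr 1 with x
    ring
  rw [MeasureTheory.integral_const_mul] at h1
  simpa using h1

/-! ### Gaussian test functions -/

/-- The sum of the two shifts of the Gaussian `exp (-N z²)` by `± s` in the imaginary direction. -/
noncomputable def gaussianShiftSum (N s x : ℝ) : ℂ :=
  Complex.exp (-N * (x + s * Complex.I) ^ 2) +
    Complex.exp (-N * (x + (-s : ℝ) * Complex.I) ^ 2)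

theorem continuous_gaussianShiftSum (N s : ℝ) : Continuous (gaussianShiftSum N s) := by
  unfold gaussianShiftSum
  fun_prop

theorem norm_cexp_neg_mul_complex_sq (N : ℝ) (z : ℂ) :
    ‖Complex.exp (-N * z ^ 2)‖ = Real.exp (N * z.im ^ 2 - N * z.re ^ 2) := by
  rw [Complex.norm_exp]
  congr 1
  simp [sq]
  ring

theorem norm_gaussianShiftSum_le (N s x : ℝ) :
    ‖gaussianShiftSum N s x‖ ≤ 2 * Real.exp (N * s ^ 2) * Real.exp (-N * x ^ 2) := by
  have h : ∀ t : ℝ, t ^ 2 = s ^ 2 → ‖Complex.exp (-N * (x + t * Complex.I) ^ 2)‖ =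
      Real.exp (N * s ^ 2) * Real.exp (-N * x ^ 2) := by
    intro t ht
    rw [norm_cexp_neg_mul_complex_sq, ← Real.exp_add]
    simp [ht, sub_eq_add_neg]
  refine (norm_add_le _ _).trans ?_
  rw [h s rfl, h (-s) (neg_sq s)]
  linarith

theorem norm_gaussianShiftSum_le_const {N : ℝ} (hN : 0 ≤ N) (s x : ℝ) :
    ‖gaussianShiftSum N s x‖ ≤ 2 * Real.exp (N * s ^ 2) := by
  refine (norm_gaussianShiftSum_le N s x).trans (mul_le_of_le_one_right (by positivity) ?_)
  rw [Real.exp_le_one_iff]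
  nlinarith [sq_nonneg x]

/-- The contour identity for the Gaussian centred at `z - y`, followed by translation by `y`. -/
theorem integral_hypSecant_mul_gaussianShiftSum {a : ℝ} (ha : 0 < a) {N : ℝ} (hN : 0 ≤ N)
    (y z : ℝ) :
    ∫ x : ℝ, hypSecant a (x - y) * gaussianShiftSum N (Real.pi / (2 * a)) (x - z) =
      ((2 * ∫ x, ‖hypSecant a x‖ : ℝ) : ℂ) * (Real.exp (-N * (y - z) ^ 2) : ℝ) := by
  have h := integral_hypSecant_mul_shift_sub ha
    (g := fun w => Complex.exp (-N * (w + (y - z : ℝ)) ^ 2)) (by fun_prop)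
    (B := Real.exp (N * (Real.pi / (2 * a)) ^ 2)) fun w hw => by
      rw [norm_cexp_neg_mul_complex_sq]
      refine Real.exp_le_exp.mpr ?_
      have h1 : w.im ^ 2 ≤ (Real.pi / (2 * a)) ^ 2 := sq_le_sq' (abs_le.mp hw).1 (abs_le.mp hw).2
      have h2 := mul_le_mul_of_nonneg_left h1 hN
      have h3 : 0 ≤ N * (w.re + (y - z)) ^ 2 := by positivity
      simp
      linarith
  have hb : MeasureTheory.Integrable fun x : ℝ =>
      hypSecant a x * gaussianShiftSum N (Real.pi / (2 * a)) (x + (y - z)) :=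
    (integrable_hypSecant ha.ne').mul_bdd
      ((continuous_gaussianShiftSum _ _).comp (by fun_prop)).aestronglyMeasurable
      (.of_forall fun x => norm_gaussianShiftSum_le_const hN _ _)
  have hc := (integrable_hypSecant ha.ne').mul_const
    (2 * (Real.exp (-N * (y - z) ^ 2) : ℝ) : ℂ)
  have h1 : ∫ x : ℝ, (hypSecant a x * gaussianShiftSum N (Real.pi / (2 * a)) (x + (y - z)) -
      hypSecant a x * (2 * (Real.exp (-N * (y - z) ^ 2) : ℝ) : ℂ)) = 0 := by
    refine Eq.trans ?_ h
    congr 1 with x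
    rw [← mul_sub, gaussianShiftSum]
    push_cast
    rw [zero_add, add_right_comm (x : ℂ) _ (y - z : ℂ), add_right_comm (x : ℂ) _ (y - z : ℂ)]
  rw [MeasureTheory.integral_sub hb hc, sub_eq_zero, MeasureTheory.integral_mul_const,
    integral_hypSecant] at h1
  rw [← MeasureTheory.integral_add_right_eq_self _ y]
  simp only [add_sub_cancel_right]
  simp only [add_sub_assoc] at h1 ⊢
  rw [h1]
  push_cast
  ring

/-! ### Sums over separated sets and a Schur test -/

theorem summable_exp_neg_mul_abs_int {δ : ℝ} (hδ : 0 < δ) :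
    Summable fun k : ℤ => Real.exp (-δ * |(k : ℝ)|) := by
  have h : Summable fun n : ℕ => Real.exp (-δ * |(n : ℝ)|) := by
    have := Real.summable_exp_nat_mul_iff.mpr (neg_lt_zero.mpr hδ)
    refine this.congr fun n => ?_
    rw [Nat.abs_cast, mul_comm]
  refine Summable.of_nat_of_neg (by simpa using h) (by simpa using h)

/-- Two points in one cell of length `δ` would be closer than `δ`. The free base point `x` makes
later bounds uniform in `x`. -/
theorem floor_div_injOn_of_separated {Γ : Set ℝ} {δ : ℝ} (hδ : 0 < δ)
    (h : ∀ γ ∈ Γ, ∀ γ' ∈ Γ, γ ≠ γ' → δ ≤ |γ - γ'|) (x : ℝ) :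
    Function.Injective fun γ : Γ => ⌊((γ : ℝ) - x) / δ⌋ := by
  intro γ γ' hk
  by_contra hne
  have h1 := h γ γ.2 γ' γ'.2 fun h => hne (Subtype.ext h)
  have h2 := Int.abs_sub_lt_one_of_floor_eq_floor hk
  rw [← sub_div, abs_div, abs_of_pos hδ, div_lt_one hδ, sub_sub_sub_cancel_right] at h2
  linarith

theorem IsSeparatedSet.countable {Γ : Set ℝ} (h : IsSeparatedSet Γ) : Countable Γ := by
  obtain ⟨δ, hδ, h⟩ := h
  exact (floor_div_injOn_of_separated hδ h 0).countable

theorem IsSeparatedSet.exists_sum_exp_le {Γ : Set ℝ} (h : IsSeparatedSet Γ) (A : ℝ) :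
    ∃ K : ℝ, 0 ≤ K ∧ ∀ (s : Finset Γ) (x : ℝ),
      ∑ γ ∈ s, Real.exp (A * |x - γ| - (x - γ) ^ 2) ≤ K := by
  obtain ⟨δ, hδ, h⟩ := h
  -- With `t = |x - γ|`, completing the square gives `A t - t² ≤ (A + 1)² / 4 - t`; the extra `δ`
  -- pays for rounding to a cell index.
  refine ⟨Real.exp ((A + 1) ^ 2 / 4 + δ) * ∑' k : ℤ, Real.exp (-δ * |(k : ℝ)|),
    by positivity, fun s x => ?_⟩
  have hinj := floor_div_injOn_of_separated hδ h x
  have hterm : ∀ γ : Γ, Real.exp (A * |x - γ| - (x - γ) ^ 2) ≤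
      Real.exp ((A + 1) ^ 2 / 4 + δ) * Real.exp (-δ * |(⌊((γ : ℝ) - x) / δ⌋ : ℝ)|) := by
    intro γ
    rw [← Real.exp_add]
    refine Real.exp_le_exp.mpr ?_
    have h1 : δ * |(⌊((γ : ℝ) - x) / δ⌋ : ℝ)| ≤ |x - γ| + δ := by
      have h2 := Int.floor_le (((γ : ℝ) - x) / δ)
      have h3 := Int.lt_floor_add_one (((γ : ℝ) - x) / δ)
      have h4 : |(⌊((γ : ℝ) - x) / δ⌋ : ℝ)| ≤ |((γ : ℝ) - x) / δ| + 1 := by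
        rw [abs_le]
        constructor
        · linarith [neg_abs_le (((γ : ℝ) - x) / δ)]
        · linarith [le_abs_self (((γ : ℝ) - x) / δ)]
      calc δ * |(⌊((γ : ℝ) - x) / δ⌋ : ℝ)| ≤ δ * (|((γ : ℝ) - x) / δ| + 1) := by gcongr
        _ = |x - γ| + δ := by
          rw [abs_div, abs_of_pos hδ, abs_sub_comm]
          field_simp
    have h5 : (x - γ) ^ 2 = |x - γ| ^ 2 := (sq_abs _).symm
    nlinarith [sq_nonneg (|x - γ| - (A + 1) / 2)]
  calc _ ≤ ∑ γ ∈ s, Real.exp ((A + 1) ^ 2 / 4 + δ) *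
        Real.exp (-δ * |(⌊((γ : ℝ) - x) / δ⌋ : ℝ)|) := Finset.sum_le_sum fun γ _ => hterm γ
    _ = Real.exp ((A + 1) ^ 2 / 4 + δ) *
        ∑ k ∈ s.map ⟨_, hinj⟩, Real.exp (-δ * |(k : ℝ)|) := by
      rw [← Finset.mul_sum, Finset.sum_map]
      rfl
    _ ≤ _ := by
      gcongr
      exact (summable_exp_neg_mul_abs_int hδ).sum_le_tsum _ fun _ _ => (Real.exp_pos _).le

theorem IsSeparatedSet.exists_gaussian_offDiag_sum_le {Γ : Set ℝ} (h : IsSeparatedSet Γ) (A : ℝ)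
    {ε : ℝ} (hε : 0 < ε) :
    ∃ N : ℝ, 1 ≤ N ∧ ∀ (s : Finset Γ) (γ' : Γ),
      ∑ γ ∈ s, (if γ' = γ then 0 else
        Real.exp (-N * ((γ' : ℝ) - γ) ^ 2) * Real.exp (A * |(γ' : ℝ) - γ|)) ≤ ε := by
  obtain ⟨K, hK, hsum⟩ := h.exists_sum_exp_le A
  obtain ⟨δ, hδ, h⟩ := h
  have hlim : Tendsto (fun M : ℝ => Real.exp (-(M * δ ^ 2)) * K) atTop (𝓝 (0 * K)) := by
    refine Tendsto.mul_const _ (Real.tendsto_exp_neg_atTop_nhds_zero.comp ?_)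
    exact tendsto_id.atTop_mul_const (by positivity)
  rw [zero_mul] at hlim
  obtain ⟨M, hM, hM0⟩ := ((hlim.eventually (gt_mem_nhds hε)).and (eventually_ge_atTop 0)).exists
  -- The share `M` supplies the small factor `e^{-Mδ²}` off the diagonal; the remaining `1` keeps a
  -- Gaussian that makes the sum converge.
  refine ⟨M + 1, by linarith, fun s γ' => le_trans ?_ hM.le⟩
  calc _ ≤ ∑ γ ∈ s, Real.exp (-(M * δ ^ 2)) *
        Real.exp (A * |(γ' : ℝ) - γ| - ((γ' : ℝ) - γ) ^ 2) := by
        refine Finset.sum_le_sum fun γ _ => ?_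
        split_ifs with hγ
        · positivity
        · rw [← Real.exp_add, ← Real.exp_add]
          refine Real.exp_le_exp.mpr ?_
          have h1 := h γ' γ'.2 γ γ.2 fun h => hγ (Subtype.ext h)
          have h2 : δ ^ 2 ≤ ((γ' : ℝ) - γ) ^ 2 := by
            rw [← sq_abs ((γ' : ℝ) - γ)]
            gcongr
          nlinarith [mul_le_mul_of_nonneg_left h2 hM0]
    _ ≤ _ := by
        rw [← Finset.mul_sum]
        exact mul_le_mul_of_nonneg_left (hsum s γ') (Real.exp_pos _).le

/-- A weighted Schur test for a perturbation of the identity; the weight `w` may be unbounded. -/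
theorem sum_mul_le_of_le_add_tsum {ι : Type*} {u d w : ι → ℝ} {k ρ : ι → ι → ℝ} {D : ℝ}
    (hu : ∀ i, 0 ≤ u i) (hd : ∀ i, 0 ≤ d i) (hw : ∀ i, 0 ≤ w i) (hk : ∀ i j, 0 ≤ k i j)
    (hρ : ∀ i j, 1 ≤ ρ i j) (hus : Summable u) (hwρ : ∀ i j, w i ≤ w j * ρ i j)
    (hks : ∀ i, Summable fun j => k i j * u j) (hle : ∀ i, u i ≤ d i + ∑' j, k i j * u j)
    (hkρ : ∀ (s : Finset ι) (j : ι), ∑ i ∈ s, k i j * ρ i j ≤ 1 / 2)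
    (hD : ∀ s : Finset ι, ∑ i ∈ s, w i * d i ≤ D) (s : Finset ι) :
    ∑ i ∈ s, w i * u i ≤ 2 * D := by
  -- Truncating the weight at `R` makes `∑ v u` finite, so half of it can be absorbed. As `R ≥ w i`
  -- on `s`, nothing is lost there, and `ρ ≥ 1` preserves the weight inequality.
  set R : ℝ := ∑ i ∈ s, w i with hR
  set v : ι → ℝ := fun i => min (w i) R with hv
  have hR0 : 0 ≤ R := Finset.sum_nonneg fun i _ => hw i
  have hv0 : ∀ i, 0 ≤ v i := fun i => le_min (hw i) hR0
  have hvρ : ∀ i j, v i ≤ v j * ρ i j := by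
    intro i j
    have hρ0 : 0 ≤ ρ i j := zero_le_one.trans (hρ i j)
    rw [hv, min_mul_of_nonneg _ _ hρ0]
    exact le_min ((min_le_left _ _).trans (hwρ i j))
      ((min_le_right _ _).trans (le_mul_of_one_le_right hR0 (hρ i j)))
  have hvs : Summable fun i => v i * u i :=
    (hus.mul_left R).of_nonneg_of_le (fun i => mul_nonneg (hv0 i) (hu i))
      fun i => mul_le_mul_of_nonneg_right (min_le_right _ _) (hu i)
  have hfin : ∀ t : Finset ι, ∑ i ∈ t, v i * u i ≤ D + (∑' i, v i * u i) / 2 := by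
    intro t
    have h1 : ∑ i ∈ t, v i * ∑' j, k i j * u j ≤ (∑' i, v i * u i) / 2 := by
      simp_rw [← tsum_mul_left]
      rw [← Summable.tsum_finsetSum fun i _ => (hks i).mul_left (v i), ← tsum_div_const]
      refine Summable.tsum_le_tsum (fun j => ?_)
        (summable_sum fun i _ => (hks i).mul_left (v i)) (hvs.div_const 2)
      calc ∑ i ∈ t, v i * (k i j * u j) ≤ ∑ i ∈ t, (v j * u j) * (k i j * ρ i j) := by
            refine Finset.sum_le_sum fun i _ => ?_
            calc v i * (k i j * u j) ≤ (v j * ρ i j) * (k i j * u j) :=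
                  mul_le_mul_of_nonneg_right (hvρ i j) (mul_nonneg (hk i j) (hu j))
              _ = _ := by ring
        _ ≤ v j * u j * (1 / 2) := by
            rw [← Finset.mul_sum]
            exact mul_le_mul_of_nonneg_left (hkρ t j) (mul_nonneg (hv0 j) (hu j))
        _ = _ := by ring
    have h2 : ∑ i ∈ t, v i * d i ≤ D := (Finset.sum_le_sum fun i _ =>
      mul_le_mul_of_nonneg_right (min_le_left _ _) (hd i)).trans (hD t)
    calc _ ≤ ∑ i ∈ t, (v i * d i + v i * ∑' j, k i j * u j) := by
          refine Finset.sum_le_sum fun i _ => ?_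
          rw [← mul_add]
          exact mul_le_mul_of_nonneg_left (hle i) (hv0 i)
      _ ≤ _ := by
          rw [Finset.sum_add_distrib]
          exact add_le_add h2 h1
  have hts : ∑' i, v i * u i ≤ D + (∑' i, v i * u i) / 2 := hvs.tsum_le_of_sum_le hfin
  have hsv : ∑ i ∈ s, w i * u i = ∑ i ∈ s, v i * u i := by
    refine Finset.sum_congr rfl fun i hi => ?_
    rw [hv]
    simp only
    rw [min_eq_left (Finset.single_le_sum (fun i _ => hw i) hi)]
  rw [hsv]
  linarith [hfin s]

/-! ### Functions in `V^1_Γ(H_a)` and their Gaussian moments -/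

theorem memℓp_one_iff_summable_norm {ι : Type*} {c : ι → ℂ} :
    Memℓp c 1 ↔ Summable fun i => ‖c i‖ := by
  rw [memℓp_gen_iff (by simp)]
  simp

theorem IsCoeffs.continuous {a : ℝ} {Γ : Set ℝ} {f : ℝ → ℂ} {c : Γ → ℂ}
    (hf : IsCoeffs 1 Γ (hypSecant a) f c) : Continuous f := by
  have h : f = fun x => ∑' γ : Γ, c γ * hypSecant a (x - γ) := funext fun x => (hf.2 x).tsum_eq.symm
  rw [h]
  refine continuous_tsum (fun γ => ?_) (memℓp_one_iff_summable_norm.mp hf.1) fun γ x => ?_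
  · exact continuous_const.mul ((continuous_hypSecant a).comp (by fun_prop))
  · rw [norm_mul]
    exact mul_le_of_le_one_right (norm_nonneg _) (norm_hypSecant_le_one _ _)

theorem IsCoeffs.integrable {a : ℝ} (ha : a ≠ 0) {Γ : Set ℝ} (hΓ : Γ.Countable) {f : ℝ → ℂ}
    {c : Γ → ℂ} (hf : IsCoeffs 1 Γ (hypSecant a) f c) : MeasureTheory.Integrable f := by
  have := hΓ.to_subtype
  refine ⟨hf.continuous.aestronglyMeasurable, ?_⟩
  have hF : ∀ γ : Γ, MeasureTheory.Integrable fun x : ℝ => c γ * hypSecant a (x - γ) := fun γ =>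
    ((integrable_hypSecant ha).comp_sub_right (γ : ℝ)).const_mul (c γ)
  have hint : ∀ γ : Γ, ∫⁻ x : ℝ, ‖c γ * hypSecant a (x - γ)‖ₑ =
      ENNReal.ofReal (‖c γ‖ * ∫ x, ‖hypSecant a x‖) := by
    intro γ
    rw [← MeasureTheory.ofReal_integral_norm_eq_lintegral_enorm (hF γ)]
    simp_rw [norm_mul]
    rw [MeasureTheory.integral_const_mul,
      MeasureTheory.integral_sub_right_eq_self (fun x => ‖hypSecant a x‖)]
  have hle : ∫⁻ x, ‖f x‖ₑ ≤ ∫⁻ x, ∑' γ : Γ, ‖c γ * hypSecant a (x - γ)‖ₑ := by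
    refine MeasureTheory.lintegral_mono fun x => ?_
    rw [← (hf.2 x).tsum_eq]
    exact enorm_tsum_le_tsum_enorm
  rw [MeasureTheory.lintegral_tsum fun γ => (hF γ).aestronglyMeasurable.enorm] at hle
  simp_rw [hint] at hle
  refine hle.trans_lt ?_
  exact ((memℓp_one_iff_summable_norm.mp hf.1).mul_right _).tsum_ofReal_lt_top

theorem IsCoeffs.hasSum_integral_mul_gaussianShiftSum {a : ℝ} (ha : 0 < a) {Γ : Set ℝ}
    (hΓ : Γ.Countable) {f : ℝ → ℂ} {c : Γ → ℂ} (hf : IsCoeffs 1 Γ (hypSecant a) f c) {N : ℝ}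
    (hN : 0 ≤ N) (z : ℝ) :
    HasSum (fun γ : Γ => c γ * (((2 * ∫ x, ‖hypSecant a x‖ : ℝ) : ℂ) *
        (Real.exp (-N * ((γ : ℝ) - z) ^ 2) : ℝ)))
      (∫ x, f x * gaussianShiftSum N (Real.pi / (2 * a)) (x - z)) := by
  have := hΓ.to_subtype
  set φ : ℝ → ℂ := fun x => gaussianShiftSum N (Real.pi / (2 * a)) (x - z) with hφ
  set B : ℝ := 2 * Real.exp (N * (Real.pi / (2 * a)) ^ 2) with hB
  have hφc : Continuous φ := (continuous_gaussianShiftSum _ _).comp (by fun_prop)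
  have hφB : ∀ x, ‖φ x‖ ≤ B := fun x => norm_gaussianShiftSum_le_const hN _ _
  have hH : ∀ γ : Γ, MeasureTheory.Integrable fun x : ℝ => c γ * hypSecant a (x - γ) := fun γ =>
    ((integrable_hypSecant ha.ne').comp_sub_right (γ : ℝ)).const_mul (c γ)
  have hF : ∀ γ : Γ, MeasureTheory.Integrable fun x : ℝ => c γ * hypSecant a (x - γ) * φ x :=
    fun γ => (hH γ).mul_bdd hφc.aestronglyMeasurable (.of_forall hφB)
  have hs : Summable fun γ : Γ => ∫ x : ℝ, ‖c γ * hypSecant a (x - γ) * φ x‖ := by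
    refine ((memℓp_one_iff_summable_norm.mp hf.1).mul_right
      ((∫ x, ‖hypSecant a x‖) * B)).of_nonneg_of_le (fun γ => by positivity) fun γ => ?_
    calc ∫ x : ℝ, ‖c γ * hypSecant a (x - γ) * φ x‖
        ≤ ∫ x : ℝ, ‖c γ * hypSecant a (x - γ)‖ * B := by
          refine MeasureTheory.integral_mono (hF γ).norm ((hH γ).norm.mul_const B) fun x => ?_
          simp only
          rw [norm_mul]
          exact mul_le_mul_of_nonneg_left (hφB x) (norm_nonneg _)
      _ = _ := by
          simp_rw [norm_mul]
          rw [MeasureTheory.integral_mul_const, MeasureTheory.integral_const_mul,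
            MeasureTheory.integral_sub_right_eq_self (fun x => ‖hypSecant a x‖), mul_assoc]
  have h := MeasureTheory.hasSum_integral_of_summable_integral_norm hF hs
  have hsum : ∀ x, ∑' γ : Γ, c γ * hypSecant a (x - γ) * φ x = f x * φ x := fun x =>
    ((hf.2 x).mul_right (φ x)).tsum_eq
  simp_rw [hsum, mul_assoc, MeasureTheory.integral_const_mul] at h
  refine h.congr_fun fun γ => ?_
  rw [integral_hypSecant_mul_gaussianShiftSum ha hN]

/-! ### Exponential weights -/

theorem hypSecant_eq_of_abs_eq {a b : ℝ} (hb : |b| = a) : hypSecant a = hypSecant b := by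
  ext x
  rw [hypSecant_eq_cosh, hypSecant_eq_cosh, ← hb, ← Real.cosh_abs (b * x), ← Real.cosh_abs,
    abs_mul, abs_mul, abs_abs]

/-- Rests on `e^{2bx} + e^{2bγ} = e^{b(x+γ)} (e^{b(x-γ)} + e^{-b(x-γ)})`. Evenness of `H_a` allows
both signs of `b`. -/
theorem exp_mul_hypSecant_sub {a b : ℝ} (hb : |b| = a) (x γ : ℝ) :
    (Real.exp (2 * b * x) : ℂ) * hypSecant a (x - γ) =
      (Real.exp (b * x) : ℂ) * Real.exp (b * γ) -
        (Real.exp (2 * b * γ) : ℂ) * hypSecant a (x - γ) := by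
  rw [hypSecant_eq_of_abs_eq hb, hypSecant]
  norm_cast
  rw [eq_sub_iff_add_eq, ← add_mul, mul_one_div, div_eq_iff (by positivity)]
  rw [mul_add, ← Real.exp_add, ← Real.exp_add, ← Real.exp_add]
  congr 1 <;> congr 1 <;> ring

theorem IsCoeffs.summable_exp_mul {a b : ℝ} {Γ : Set ℝ} {f : ℝ → ℂ}
    {c : Γ → ℂ} (hf : IsCoeffs 1 Γ (hypSecant a) f c)
    (hs : Summable fun γ : Γ => Real.exp (2 * b * (γ : ℝ)) * ‖c γ‖) :
    Summable fun γ : Γ => (Real.exp (b * (γ : ℝ)) : ℂ) * c γ := by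
  refine Summable.of_norm_bounded ((memℓp_one_iff_summable_norm.mp hf.1).add hs) fun γ => ?_
  rw [norm_mul, Complex.norm_real, Real.norm_of_nonneg (Real.exp_pos _).le, ← one_add_mul]
  refine mul_le_mul_of_nonneg_right ?_ (norm_nonneg _)
  have h : Real.exp (2 * b * (γ : ℝ)) = Real.exp (b * γ) ^ 2 := by
    rw [← Real.exp_nat_mul]
    push_cast
    ring_nf
  rw [h]
  nlinarith [sq_nonneg (Real.exp (b * γ) - 1), Real.exp_pos (b * γ)]

/-- The sum `S` is left arbitrary because this decomposition is also what forces `S = 0`. -/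
theorem IsCoeffs.exp_mul_sub {a b : ℝ} (hb : |b| = a) {Γ : Set ℝ} {f : ℝ → ℂ}
    {c : Γ → ℂ} (hf : IsCoeffs 1 Γ (hypSecant a) f c)
    (hs : Summable fun γ : Γ => Real.exp (2 * b * (γ : ℝ)) * ‖c γ‖) {S : ℂ}
    (hS : HasSum (fun γ : Γ => (Real.exp (b * (γ : ℝ)) : ℂ) * c γ) S) :
    IsCoeffs 1 Γ (hypSecant a)
      (fun x => (Real.exp (2 * b * x) : ℂ) * f x - (Real.exp (b * x) : ℂ) * S)
      (fun γ => -((Real.exp (2 * b * (γ : ℝ)) : ℂ) * c γ)) := by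
  refine ⟨memℓp_one_iff_summable_norm.mpr (hs.congr fun γ => ?_), fun x => ?_⟩
  · rw [norm_neg, norm_mul, Complex.norm_real, Real.norm_of_nonneg (Real.exp_pos _).le]
  · refine (((hf.2 x).mul_left (Real.exp (2 * b * x) : ℂ)).sub
      (hS.mul_left (Real.exp (b * x) : ℂ))).congr_fun fun γ => ?_
    linear_combination (-c γ) * exp_mul_hypSecant_sub hb x γ

/-- Adding the reflected function would give an integrable function bounded below by `1`. -/
theorem not_integrable_exp_mul (b : ℝ) :
    ¬ MeasureTheory.Integrable fun x : ℝ => Real.exp (b * x) := by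
  intro h
  have h1 : MeasureTheory.Integrable fun x : ℝ => Real.exp (-(b * x)) :=
    h.comp_neg.congr (.of_forall fun x => by simp)
  have h2 : MeasureTheory.Integrable fun _ : ℝ => (1 : ℝ) := by
    refine (h.add h1).mono' (by fun_prop) (.of_forall fun x => ?_)
    have := Real.one_le_cosh (b * x)
    rw [Real.cosh_eq] at this
    simp only [norm_one, Pi.add_apply]
    linarith [Real.exp_pos (b * x), Real.exp_pos (-(b * x))]
  rw [MeasureTheory.integrable_const_iff] at h2
  simp [MeasureTheory.isFiniteMeasure_iff] at h2

theorem exp_two_mul_le {a b : ℝ} (hb : |b| = a) (x y : ℝ) :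
    Real.exp (2 * b * y) ≤ Real.exp (2 * b * x) * Real.exp (2 * a * |x - y|) := by
  rw [← Real.exp_add]
  refine Real.exp_le_exp.mpr ?_
  have h := neg_abs_le (b * (x - y))
  rw [abs_mul, hb] at h
  linarith

/-- Exponentially weighted integrability of `f` passes to its coefficients. -/
theorem IsCoeffs.summable_of_integrable {a b : ℝ} (ha : 0 < a) (hb : |b| = a) {Γ : Set ℝ}
    (hΓ : IsSeparatedSet Γ) {f : ℝ → ℂ} {c : Γ → ℂ} (hf : IsCoeffs 1 Γ (hypSecant a) f c)
    (hint : MeasureTheory.Integrable fun x : ℝ => (Real.exp (2 * b * x) : ℂ) * f x) :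
    Summable fun γ : Γ => Real.exp (2 * b * (γ : ℝ)) * ‖c γ‖ := by
  have hcount : Γ.Countable := Set.countable_coe_iff.mp hΓ.countable
  obtain ⟨N, hN1, hoff⟩ := hΓ.exists_gaussian_offDiag_sum_le (2 * a) (ε := 1 / 2) (by norm_num)
  obtain ⟨K, hK, hsum⟩ := hΓ.exists_sum_exp_le (2 * a)
  have hN : 0 ≤ N := by linarith
  set κ : ℝ := 2 * ∫ x, ‖hypSecant a x‖ with hκ
  have hκ0 : 0 < κ := mul_pos two_pos (integral_norm_hypSecant_pos ha.ne')
  set β : ℝ := Real.pi / (2 * a) with hβ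
  set φ : ℝ → ℂ := gaussianShiftSum N β with hφ
  set B : ℝ := 2 * Real.exp (N * β ^ 2) with hB
  set d : Γ → ℂ := fun γ => ∫ x, f x * φ (x - γ) with hd
  set k : Γ → Γ → ℝ := fun i j =>
    if j = i then 0 else Real.exp (-N * ((j : ℝ) - i) ^ 2) with hk
  have hk0 : ∀ i j, 0 ≤ k i j := by
    intro i j
    rw [hk]
    positivity
  have hk1 : ∀ i j, k i j ≤ 1 := by
    intro i j
    simp only [hk]
    split_ifs
    · exact zero_le_one
    · rw [Real.exp_le_one_iff]
      nlinarith [sq_nonneg ((j : ℝ) - i)]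
  have hcs := memℓp_one_iff_summable_norm.mp hf.1
  have hks : ∀ i, Summable fun j => k i j * ‖c j‖ := fun i =>
    hcs.of_nonneg_of_le (fun j => mul_nonneg (hk0 i j) (norm_nonneg _))
      fun j => mul_le_of_le_one_left (norm_nonneg _) (hk1 i j)
  -- The diagonal Gaussian entry is `1`, so `d i / κ - c i` is exactly the off-diagonal part of the
  -- matrix applied to `c`.
  have hle : ∀ i, ‖c i‖ ≤ ‖d i‖ / κ + ∑' j, k i j * ‖c j‖ := by
    intro i
    have hκ' : (κ : ℂ) ≠ 0 := by exact_mod_cast hκ0.ne'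
    have h1 : HasSum (fun j : Γ => (k i j : ℂ) * c j) (d i / κ - c i) := by
      refine (((hf.hasSum_integral_mul_gaussianShiftSum ha hcount hN i).div_const (κ : ℂ)).sub
        (hasSum_ite_eq i (c i))).congr_fun fun j => ?_
      simp only [hk]
      split_ifs with hij
      · subst hij
        simp only [sub_self, ne_eq, OfNat.ofNat_ne_zero, not_false_eq_true, zero_pow, mul_zero,
          Real.exp_zero, Complex.ofReal_one, mul_one, Complex.ofReal_zero, zero_mul]
        rw [mul_div_cancel_right₀ _ hκ', sub_self]
      · field_simp
        ring
    have h2 : ‖d i / κ - c i‖ ≤ ∑' j, k i j * ‖c j‖ := by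
      rw [← h1.tsum_eq]
      refine tsum_of_norm_bounded (hks i).hasSum fun j => ?_
      rw [norm_mul, Complex.norm_real, Real.norm_of_nonneg (hk0 i j)]
    have h3 := norm_sub_norm_le (c i) (d i / κ)
    rw [norm_sub_rev, norm_div, Complex.norm_real, Real.norm_of_nonneg hκ0.le] at h3
    linarith
  have hfint := hf.integrable ha.ne' hcount
  have hφint : ∀ γ : Γ, MeasureTheory.Integrable fun x : ℝ => f x * φ (x - γ) := fun γ =>
    hfint.mul_bdd ((continuous_gaussianShiftSum N β).comp (by fun_prop)).aestronglyMeasurable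
      (.of_forall fun x => norm_gaussianShiftSum_le_const hN β _)
  -- Moving the weight from `γ` to `x` costs `e^{2a|x-γ|}`, which the Gaussian decay of `φ` absorbs
  -- uniformly in `x`.
  have hwd : ∀ s : Finset Γ, ∑ γ ∈ s, Real.exp (2 * b * (γ : ℝ)) * (‖d γ‖ / κ) ≤
      (∫ x, ‖(Real.exp (2 * b * x) : ℂ) * f x‖ * (B * K)) / κ := by
    intro s
    simp_rw [← mul_div_assoc]
    rw [← Finset.sum_div]
    refine div_le_div_of_nonneg_right ?_ hκ0.le
    calc ∑ γ ∈ s, Real.exp (2 * b * (γ : ℝ)) * ‖d γ‖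
        ≤ ∑ γ ∈ s, ∫ x, Real.exp (2 * b * (γ : ℝ)) * ‖f x * φ (x - γ)‖ := by
          refine Finset.sum_le_sum fun γ _ => ?_
          rw [MeasureTheory.integral_const_mul]
          exact mul_le_mul_of_nonneg_left (MeasureTheory.norm_integral_le_integral_norm _)
            (Real.exp_pos _).le
      _ = ∫ x, ∑ γ ∈ s, Real.exp (2 * b * (γ : ℝ)) * ‖f x * φ (x - γ)‖ :=
          (MeasureTheory.integral_finsetSum s fun γ _ => (hφint γ).norm.const_mul _).symm
      _ ≤ _ := by
          refine MeasureTheory.integral_mono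
            (MeasureTheory.integrable_finsetSum s fun γ _ => (hφint γ).norm.const_mul _)
            (hint.norm.mul_const _) fun x => ?_
          simp only
          rw [norm_mul, Complex.norm_real, Real.norm_of_nonneg (Real.exp_pos _).le]
          calc ∑ γ ∈ s, Real.exp (2 * b * (γ : ℝ)) * ‖f x * φ (x - γ)‖
              ≤ ∑ γ ∈ s, Real.exp (2 * b * x) * ‖f x‖ * B *
                  Real.exp (2 * a * |x - γ| - (x - γ) ^ 2) := by
                refine Finset.sum_le_sum fun γ _ => ?_
                have h1 := norm_gaussianShiftSum_le N β (x - γ)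
                have h2 : Real.exp (-N * (x - γ) ^ 2) ≤ Real.exp (-(x - γ) ^ 2) := by
                  refine Real.exp_le_exp.mpr ?_
                  nlinarith [sq_nonneg (x - (γ : ℝ))]
                have h3 := exp_two_mul_le hb x γ
                rw [norm_mul, sub_eq_add_neg (2 * a * _), Real.exp_add]
                calc _ ≤ (Real.exp (2 * b * x) * Real.exp (2 * a * |x - γ|)) *
                      (‖f x‖ * (B * Real.exp (-(x - γ) ^ 2))) := by
                      gcongr
                      exact h1.trans (mul_le_mul_of_nonneg_left h2 (by positivity))
                  _ = _ := by ring
            _ ≤ _ := by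
                rw [← Finset.mul_sum, ← mul_assoc _ B K]
                exact mul_le_mul_of_nonneg_left (hsum s x) (by positivity)
  refine summable_of_sum_le (fun γ => by positivity) fun s =>
    sum_mul_le_of_le_add_tsum (u := fun γ => ‖c γ‖) (d := fun γ => ‖d γ‖ / κ) (k := k)
      (ρ := fun i j => Real.exp (2 * a * |(j : ℝ) - i|)) (fun _ => norm_nonneg _)
      (fun _ => by positivity) (fun _ => (Real.exp_pos _).le) hk0 (fun i j => ?_) hcs
      (fun i j => exp_two_mul_le hb _ _) hks hle (fun s j => ?_) hwd s
  · exact Real.one_le_exp (by positivity)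
  · refine le_trans (le_of_eq (Finset.sum_congr rfl fun i _ => ?_)) (hoff s j)
    simp only [hk, ite_mul, zero_mul]

theorem IsCoeffs.integrable_exp_mul_iff {a b : ℝ} (ha : 0 < a) (hb : |b| = a) {Γ : Set ℝ}
    (hΓ : IsSeparatedSet Γ) {f : ℝ → ℂ} {c : Γ → ℂ} (hf : IsCoeffs 1 Γ (hypSecant a) f c) :
    MeasureTheory.Integrable (fun x : ℝ => (Real.exp (2 * b * x) : ℂ) * f x) ↔
      Summable (fun γ : Γ => Real.exp (2 * b * (γ : ℝ)) * ‖c γ‖) ∧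
      HasSum (fun γ : Γ => (Real.exp (b * (γ : ℝ)) : ℂ) * c γ) 0 := by
  have hcount : Γ.Countable := Set.countable_coe_iff.mp hΓ.countable
  constructor
  · intro hint
    have hs := hf.summable_of_integrable ha hb hΓ hint
    obtain ⟨S, hS⟩ := hf.summable_exp_mul hs
    -- The difference of these two integrable functions is `e^{bx} S`.
    have h1 := (hint.sub ((hf.exp_mul_sub hb hs hS).integrable ha.ne' hcount)).norm
    refine ⟨hs, ?_⟩
    by_cases hS0 : S = 0
    · rwa [hS0] at hS
    · refine absurd ?_ (not_integrable_exp_mul b)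
      have hS1 : ‖S‖ ≠ 0 := norm_ne_zero_iff.mpr hS0
      refine (h1.mul_const ‖S‖⁻¹).congr (.of_forall fun x => ?_)
      simp only [Pi.sub_apply, sub_sub_cancel, norm_mul, Complex.norm_real,
        Real.norm_of_nonneg (Real.exp_pos _).le]
      rw [mul_assoc, mul_inv_cancel₀ hS1, mul_one]
  · rintro ⟨hs, h0⟩
    simpa only [mul_zero, sub_zero] using (hf.exp_mul_sub hb hs h0).integrable ha.ne' hcount

theorem IsCoeffs.exp_mul_mem {a b : ℝ} (ha : 0 < a) (hb : |b| = a) {Γ : Set ℝ}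
    (hΓ : IsSeparatedSet Γ) {f : ℝ → ℂ} {c : Γ → ℂ} (hf : IsCoeffs 1 Γ (hypSecant a) f c)
    (hint : MeasureTheory.Integrable (fun x : ℝ => (Real.exp (2 * b * x) : ℂ) * f x)) :
    (fun x : ℝ => (Real.exp (2 * b * x) : ℂ) * f x) ∈
      quasiShiftInvariantSpace 1 Γ (hypSecant a) := by
  obtain ⟨hs, h0⟩ := (hf.integrable_exp_mul_iff ha hb hΓ).mp hint
  exact ⟨_, by simpa only [mul_zero, sub_zero] using hf.exp_mul_sub hb hs h0⟩

end

theorem corollary4p3 (a : ℝ) (ha : 0 < a) (Γ : Set ℝ) (hΓ : IsSeparatedSet Γ)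
    (f : ℝ → ℂ) (c : Γ → ℂ) (hf : IsCoeffs 1 Γ (hypSecant a) f c) :
    ((MeasureTheory.Integrable (fun x : ℝ => (Real.exp (2 * a * x) : ℂ) * f x)
          MeasureTheory.volume ↔
        Summable (fun γ : Γ => Real.exp (2 * a * (γ : ℝ)) * ‖c γ‖) ∧
        HasSum (fun γ : Γ => (Real.exp (a * (γ : ℝ)) : ℂ) * c γ) 0) ∧
      (MeasureTheory.Integrable (fun x : ℝ => (Real.exp (2 * a * x) : ℂ) * f x)
          MeasureTheory.volume →
        (fun x : ℝ => (Real.exp (2 * a * x) : ℂ) * f x) ∈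
          quasiShiftInvariantSpace 1 Γ (hypSecant a))) ∧
    ((MeasureTheory.Integrable (fun x : ℝ => (Real.exp (-(2 * a * x)) : ℂ) * f x)
          MeasureTheory.volume ↔
        Summable (fun γ : Γ => Real.exp (-(2 * a * (γ : ℝ))) * ‖c γ‖) ∧
        HasSum (fun γ : Γ => (Real.exp (-(a * (γ : ℝ))) : ℂ) * c γ) 0) ∧
      (MeasureTheory.Integrable (fun x : ℝ => (Real.exp (-(2 * a * x)) : ℂ) * f x)
          MeasureTheory.volume →
        (fun x : ℝ => (Real.exp (-(2 * a * x)) : ℂ) * f x) ∈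
          quasiShiftInvariantSpace 1 Γ (hypSecant a))) := by
  have h1 : |a| = a := abs_of_pos ha
  have h2 : |-a| = a := by rw [abs_neg, h1]
  refine ⟨⟨hf.integrable_exp_mul_iff ha h1 hΓ, hf.exp_mul_mem ha h1 hΓ⟩, ?_⟩
  simpa only [mul_neg, neg_mul] using
    And.intro (hf.integrable_exp_mul_iff ha h2 hΓ) (hf.exp_mul_mem ha h2 hΓ)
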